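/- A function $f:2^U\to\mathbb Z$ on the subsets of a finite set $U$ is submodular if $f(A\cup\{e\})-f(A)\ge f(B\cup\{e\})-f(B)$ for all $A\subseteq B\subseteq U$ and $e\in U\setminus B$. A randomized algorithm for submodular function minimization accesses $f$ only through an evaluation oracle, which returns $f(S)$ for a queried set $S\subseteq U$. It queries in rounds: the sets queried in a round may depend only on the algorithm's random bits and on the answers received in previous rounds, and the output depends only on the random bits and on all the answers. Computation between rounds is unrestricted. The number of rounds of adaptivity of an algorithm is the number of these rounds. Theorem. For every constant $\delta>0$ there is a constant $\kappa>0$, depending only on $\delta$, such that the following holds for every integer $N\ge 2$ and every real $c$ with $1\le c\le N^{1-\delta}$. Let a randomized algorithm make at most $N^c$ evaluation queries in each round and, for every submodular function $f:2^U\to\{-N,-N+1,\dots,N-1,N\}$ on a universe $U$ with $|U|=N$, output with probability at least $2/3$ a set $S\subseteq U$ minimizing $f(S)$. Then it has at least $$\kappa\cdot\frac{N^{1/3}}{(c\log N)^{1/3}}$$ rounds of adaptivity. The same holds for algorithms which are only required to output, with probability at least $2/3$, the minimum value $\min_{S\subseteq U}f(S)$ instead of a minimizing set. -/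

import Mathlib

open MeasureTheory

universe u

namespace ParallelSFM

/-- A set function `f : 2^U → ℤ` is submodular: for `A ⊆ B` and `e ∉ B`, the marginal of `e`
on `A` is at least its marginal on `B`. -/
def IsSubmodular {U : Type} [DecidableEq U] (f : Finset U → ℤ) : Prop :=
  ∀ A B : Finset U, A ⊆ B → ∀ e : U, e ∉ B → f (insert e B) - f B ≤ f (insert e A) - f A

/-- The instances: submodular functions on an `N`-element universe whose values all lie in
`{-N, -N+1, …, N-1, N}`. -/
def IsInstance {N : ℕ} (f : Finset (Fin N) → ℤ) : Prop :=
  IsSubmodular f ∧ ∀ S : Finset (Fin N), f S ∈ Set.Icc (-(N : ℤ)) (N : ℤ)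

/-- What an algorithm has learned so far: a list with one entry for each completed round, in
chronological order; the entry is the set of pairs (queried set, answer) of that round. -/
abbrev Transcript (U : Type) : Type := List (Finset (Finset U × ℤ))

/-- A deterministic parallel evaluation-oracle algorithm with outputs in `α`. The queries of a
round depend only on the answers received in the previous rounds, and the output depends only on
the answers received in all rounds. The computation between rounds is unrestricted. -/
structure Algorithm (U : Type) (α : Type) where
  /-- the batch of sets queried in the round that follows the given transcript -/
  query : Transcript U → Finset (Finset U)
  /-- the output produced from the final transcript -/
  output : Transcript U → α

namespace Algorithm

variable {U : Type} [DecidableEq U] {α : Type}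

/-- The transcript of the first `k` rounds when the oracle evaluates `f`. -/
def transcript (A : Algorithm U α) (f : Finset U → ℤ) : ℕ → Transcript U
  | 0 => []
  | k + 1 =>
      A.transcript f k ++ [(A.query (A.transcript f k)).image fun S => (S, f S)]

/-- The batch of queries made in round `k` (rounds are numbered from `0`) on input `f`. -/
def queriesInRound (A : Algorithm U α) (f : Finset U → ℤ) (k : ℕ) : Finset (Finset U) :=
  A.query (A.transcript f k)

/-- The output on input `f` after `s` rounds of queries. -/
def run (A : Algorithm U α) (s : ℕ) (f : Finset U → ℤ) : α :=
  A.output (A.transcript f s)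

end Algorithm

/-- A randomized algorithm with `s` rounds of adaptivity: a deterministic algorithm chosen at
random, through a random seed from an arbitrary probability space, such that the output on every
input is a random variable (for the discrete σ-algebra on the outputs). An algorithm which may
stop earlier makes no queries in its remaining rounds. -/
structure RandomizedAlgorithm (U : Type) [DecidableEq U] (α : Type) (s : ℕ) where
  /-- the space of random seeds -/
  Ω : Type u
  [measurableSpace : MeasurableSpace Ω]
  /-- the law of the seed -/
  μ : Measure Ω
  [isProbabilityMeasure : IsProbabilityMeasure μ]
  /-- the deterministic algorithm that is run with a given seed -/
  alg : Ω → Algorithm U α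
  measurable_run : ∀ f : Finset U → ℤ, Measurable[_, ⊤] fun ω => (alg ω).run s f

attribute [instance] RandomizedAlgorithm.measurableSpace
  RandomizedAlgorithm.isProbabilityMeasure

namespace RandomizedAlgorithm

variable {N : ℕ} {α : Type} {s : ℕ}

/-- On every instance and for every seed, at most `q` evaluation queries are made in each of the
`s` rounds. -/
def MakesAtMost (A : RandomizedAlgorithm.{u} (Fin N) α s) (q : ℝ) : Prop :=
  ∀ f : Finset (Fin N) → ℤ, IsInstance f → ∀ ω : A.Ω, ∀ k < s,
    (((A.alg ω).queriesInRound f k).card : ℝ) ≤ q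

/-- On every instance, the output is correct with probability at least `p`. -/
def SucceedsWithProb (A : RandomizedAlgorithm.{u} (Fin N) α s)
    (correct : (Finset (Fin N) → ℤ) → α → Prop) (p : ℝ) : Prop :=
  ∀ f : Finset (Fin N) → ℤ, IsInstance f → p ≤ A.μ.real {ω | correct f ((A.alg ω).run s f)}

end RandomizedAlgorithm

/-- `S` minimizes `f`. -/
def IsMinimizer {U : Type} (f : Finset U → ℤ) (S : Finset U) : Prop :=
  ∀ T : Finset U, f S ≤ f T

/-- `v` is the minimum value of `f`. -/
def IsMinValue {U : Type} (f : Finset U → ℤ) (v : ℤ) : Prop :=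
  IsLeast (Set.range f) v

end ParallelSFM

namespace ParallelSFM

/-! The hard instances hide a random ordered partition. Part of the universe is arranged in `2 * R`
rows of `rowSize g R` elements, and each column is permuted independently by `σ`. Only the numbers
`x i` of elements of `S` in row `i`, and the suffix sums `X i`, matter. Two mutually nested,
truncated functions are built from them; they are monotone submodular, and their sum minus the
modular total `X 0` is the hard function with `m` levels.

One level is revealed per round. A set whose row counts agree up to `g` from row `k` on gets the
same value for every number of levels from `k + 1` to `R`, by `chain_eq_of_balanced`, and the
function with `k` levels sees only the first `k` rows of `σ`, by `hardFun_congr`. So, as long as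
earlier queries were balanced, the queries of round `k` depend only on the first `k` rows. The later
rows are then still exchangeable in each column, and Hoeffding's inequality with a union bound makes
all queries of the round balanced for most `σ` (`card_exists_unbalanced_le`). Hence `m + 1` rounds
rarely distinguish `m + 1` levels from `m + 2`.

Yet one more level lowers the minimum by exactly 1 and leaves no common minimizer
(`minVal_le_hardFun`, `exists_hardFun_le`). Averaging over `σ` and the seed contradicts success
probability 2/3. The array needs about `g * R ^ 2` elements and concentration needs `g / R` at least
of order `c * log N`, so `R` can be of order `(N / (c * log N)) ^ (1/3)`. -/

/-- The two nested rank functions on the levels `i, …, i + t`, for row counts `x`, suffix counts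
`X`, suffix capacities `K` and row capacities `c`. -/
def chain (K c x X : ℕ → ℤ) : ℕ → ℕ → ℤ × ℤ
  | 0, i => (X i, min (K i) (X i))
  | t + 1, i =>
      (min (x i) (c i) + (chain K c x X t (i + 1)).2,
        min (K i) (x i + (chain K c x X t (i + 1)).1))

/-- The excess of the two nested rank functions over the suffix count. -/
def excess (K c x X : ℕ → ℤ) (t i : ℕ) : ℤ :=
  (chain K c x X t i).2 + (chain K c x X t i).1 - X i

/-! ### The nested recursion and its stabilization on balanced counts -/

section Chain

variable {K c x X : ℕ → ℤ}

theorem chain_bounds {m : ℕ} (hK : ∀ i ≤ m, 0 ≤ K i) (hc : ∀ i ≤ m, 0 ≤ c i)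
    (hx : ∀ i, 0 ≤ x i) (hX : ∀ i, X i = x i + X (i + 1)) (hX0 : ∀ i, 0 ≤ X i) (t : ℕ) :
    ∀ i, i + t ≤ m →
      (0 ≤ (chain K c x X t i).1 ∧ (chain K c x X t i).1 ≤ X i) ∧
      0 ≤ (chain K c x X t i).2 ∧ (chain K c x X t i).2 ≤ X i := by
  induction t with
  | zero =>
    intro i hi
    have := hK i hi; have := hX0 i
    simp only [chain]
    omega
  | succ t ih =>
    intro i hi
    have h := ih (i + 1) (by omega)
    have := hK i (by omega); have := hc i (by omega); have := hx i; have := hX i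
    simp only [chain]
    omega

theorem chain_congr {y Y : ℕ → ℤ} {m : ℕ} (hxy : ∀ i < m, x i = y i) (hXY : ∀ i ≤ m, X i = Y i)
    (t : ℕ) : ∀ i, i + t ≤ m → chain K c x X t i = chain K c y Y t i := by
  induction t with
  | zero => intro i hi; simp [chain, hXY i (by omega)]
  | succ t ih =>
    intro i hi
    simp only [chain, ih (i + 1) (by omega), hxy i (by omega)]

/-- This recursion drives both bounds on the minimum: either row `i` is paid for and the problem
moves one level down, or the cap `K i` is active and the recursion stops. -/
theorem excess_succ (hX : ∀ i, X i = x i + X (i + 1)) (t i : ℕ) :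
    excess K c x X (t + 1) i =
      min (min (x i) (c i) + excess K c x X t (i + 1))
        (K i + (chain K c x X (t + 1) i).1 - X i) := by
  have := hX i
  simp only [excess, chain]
  omega

/-- Row counts that agree up to `g` on the rows `i, …, r - 1`. -/
def Balanced (x : ℕ → ℤ) (g : ℤ) (r i : ℕ) : Prop :=
  ∀ j l, i ≤ j → j < r → i ≤ l → l < r → x j - x l ≤ g

theorem Balanced.mono {g : ℤ} {r i i' : ℕ} (h : Balanced x g r i) (hi : i ≤ i') :
    Balanced x g r i' :=
  fun j l hj hj' hl hl' => h j l (hi.trans hj) hj' (hi.trans hl) hl'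

/-- Once the second component equals `min (K i) (X i)` at every depth, the first component one level
up no longer depends on the depth either, provided the depth is at least 1. Unbalanced rows above
only apply the same recursion to equal inputs. -/
theorem chain_eq_of_snd {g : ℤ} {R : ℕ}
    (h : ∀ t i, Balanced x g (2 * R) i → i + t ≤ R →
      (chain K c x X t i).2 = min (K i) (X i)) (d : ℕ) :
    ∀ i j, Balanced x g (2 * R) (i + d) → d + 1 ≤ j → i + j ≤ R →
      chain K c x X j i = chain K c x X (d + 1) i := by
  induction d with
  | zero =>
    intro i j hb hj hR
    obtain ⟨j, rfl⟩ : ∃ j', j = j' + 1 := ⟨j - 1, by omega⟩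
    refine Prod.ext ?_ ?_
    · simp only [chain]
      rw [h j (i + 1) (hb.mono (by omega)) (by omega)]
    · rw [h _ i hb hR, h _ i hb (by omega)]
  | succ d ih =>
    intro i j hb hj hR
    obtain ⟨j, rfl⟩ : ∃ j', j = j' + 1 := ⟨j - 1, by omega⟩
    have := ih (i + 1) j (by rwa [show i + 1 + d = i + (d + 1) by ring]) (by omega) (by omega)
    rw [chain, this]
    rfl

end Chain

/-! ### Capacities, hiding of levels, and the minimum of the recursion -/

section Parameters

variable (g R : ℕ)

/-- The number of elements of a row. -/
def rowSize : ℕ := 28 * (g * R) + 10 * g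

/-- The capacity of the union of the rows `i, i + 1, …`. -/
def suffixCap (i : ℕ) : ℤ := 14 * (g * R) * (2 * R - i) + 2 * (g * R)

/-- The capacity of the row `i`. -/
def rowCap (i : ℕ) : ℤ := 14 * (g * R) + 3 * g + (10 * g + 1) * (R - i)

/-- The minimum of the function with `i + 1` levels. -/
def minVal (i : ℕ) : ℤ := -6 * (g * R) + 3 * g + R - i

variable {g R : ℕ} {x X : ℕ → ℤ}

theorem suffixCap_add_two (i : ℕ) : suffixCap g R i = suffixCap g R (i + 2) + 28 * (g * R) := by
  simp only [suffixCap]; push_cast; ring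

/-- A suffix of rows with at least `b` elements each. -/
theorem le_sum_of_forall_le {R i : ℕ} {b : ℤ} (hi : i ≤ 2 * R)
    (hX : ∀ i, X i = x i + X (i + 1)) (hXr : X (2 * R) = 0)
    (h : ∀ j, i ≤ j → j < 2 * R → b ≤ x j) : (2 * R - i : ℤ) * b ≤ X i := by
  induction hi using Nat.decreasingInduction with
  | self => simp [hXr]
  | of_succ k hk ih =>
    have h1 := ih fun j hj hj' => h j (by omega) hj'
    have h2 := h k le_rfl hk
    rw [hX k]
    push_cast at h1
    linarith

theorem sum_le_of_forall_le {R i : ℕ} {b : ℤ} (hi : i ≤ 2 * R)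
    (hX : ∀ i, X i = x i + X (i + 1)) (hXr : X (2 * R) = 0)
    (h : ∀ j, i ≤ j → j < 2 * R → x j ≤ b) : X i ≤ (2 * R - i : ℤ) * b := by
  induction hi using Nat.decreasingInduction with
  | self => simp [hXr]
  | of_succ k hk ih =>
    have h1 := ih fun j hj hj' => h j (by omega) hj'
    have h2 := h k le_rfl hk
    rw [hX k]
    push_cast at h1
    linarith

/-- Two levels at a time, the suffix capacity grows by `28 * (g * R)`, that is `14 * (g * R)` per
row. If the row cap truncates, balance makes all rows so large that both suffix caps are already
saturated. If it does not truncate, either the inner suffix cap is inactive, or some row is large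
and balance saturates the outer cap as well. The slack `2 * (g * R)` in `suffixCap` separates these
cases; using only `R` of the `2 * R` rows as levels leaves enough rows to absorb it. -/
theorem chain_snd_of_balanced (hX : ∀ i, X i = x i + X (i + 1)) (hXr : X (2 * R) = 0) (t : ℕ) :
    ∀ i, Balanced x g (2 * R) i → i + t ≤ R →
      (chain (suffixCap g R) (rowCap g R) x X t i).2 = min (suffixCap g R i) (X i) := by
  induction t using Nat.twoStepInduction with
  | zero => intro i _ _; rfl
  | one => intro i _ _; simp only [chain, ← hX]
  | more t ih _ =>
    intro i hb hR
    have e : (chain (suffixCap g R) (rowCap g R) x X (t + 2) i).2 =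
        min (suffixCap g R i) (x i + (min (x (i + 1)) (rowCap g R (i + 1)) +
          (chain (suffixCap g R) (rowCap g R) x X t (i + 2)).2)) := rfl
    rw [e, ih (i + 2) (hb.mono (by omega)) (by omega)]
    have hX1 := hX i
    have hX2 : X (i + 1) = x (i + 1) + X (i + 2) := hX (i + 1)
    have hK := suffixCap_add_two (g := g) (R := R) i
    have hgR : (0 : ℤ) ≤ g * R := by positivity
    have hiR : (i : ℤ) + 2 ≤ R := by exact_mod_cast (by omega : i + 2 ≤ R)
    have hc : (14 : ℤ) * (g * R) + 3 * g ≤ rowCap g R (i + 1) := by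
      have : (0 : ℤ) ≤ (10 * g + 1) * (R - (i + 1)) :=
        mul_nonneg (by positivity) (by linarith)
      simp only [rowCap]; push_cast; linarith
    have hiR' : (0 : ℤ) ≤ i := by positivity
    have hg : (0 : ℤ) ≤ g := by positivity
    rcases lt_or_ge (rowCap g R (i + 1)) (x (i + 1)) with h1 | h1
    -- The row cap is at least `14 * (g * R) + 3 * g`, so balance costs one `g` and leaves an excess
    -- of `2 * g` per row; at least `R` remaining rows cover the slack `2 * (g * R)`.
    · have hall : ∀ j, i ≤ j → j < 2 * R → 14 * (g * R) + 2 * g ≤ x j := fun j hj hj' => by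
        have := hb (i + 1) j (by omega) (by omega) hj hj'
        linarith
      have hi := hall i le_rfl (by omega)
      have hs := le_sum_of_forall_le (i := i + 2) (by omega) hX hXr
        fun j hj hj' => hall j (by omega) hj'
      have hK2 : suffixCap g R (i + 2) ≤ X (i + 2) := by
        refine le_trans ?_ hs
        have : (0 : ℤ) ≤ (R - (i + 2)) * g := mul_nonneg (by linarith) hg
        simp only [suffixCap]; push_cast; linarith
      omega
    · rcases le_or_gt (X (i + 2)) (suffixCap g R (i + 2)) with h2 | h2
      · omega
      · obtain ⟨j, hj, hj', hlt⟩ : ∃ j, i + 2 ≤ j ∧ j < 2 * R ∧ 14 * (g * R) + g < x j := by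
          by_contra! hcon
          have hs := sum_le_of_forall_le (i := i + 2) (by omega) hX hXr hcon
          have : (0 : ℤ) ≤ (i + 2) * g := by positivity
          refine absurd (h2.trans_le hs) (not_lt.2 ?_)
          simp only [suffixCap]; push_cast; linarith
        have := hb j i (by omega) hj' (by omega) (by omega)
        have := hb j (i + 1) (by omega) hj' (by omega) (by omega)
        omega

theorem chain_eq_of_balanced (hX : ∀ i, X i = x i + X (i + 1)) (hXr : X (2 * R) = 0) {k j : ℕ}
    (hb : Balanced x g (2 * R) k) (hkj : k + 1 ≤ j) (hj : j ≤ R) :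
    chain (suffixCap g R) (rowCap g R) x X j 0 =
      chain (suffixCap g R) (rowCap g R) x X (k + 1) 0 :=
  chain_eq_of_snd (fun t i => chain_snd_of_balanced hX hXr t i) k 0 j (by simpa using hb) hkj
    (by omega)

theorem suffixCap_nonneg {i : ℕ} (hi : i ≤ 2 * R) : 0 ≤ suffixCap g R i := by
  have : (i : ℤ) ≤ 2 * R := by exact_mod_cast hi
  have : (0 : ℤ) ≤ 14 * (g * R) * (2 * R - i) := mul_nonneg (by positivity) (by linarith)
  simp only [suffixCap]
  positivity

theorem rowCap_pos (hg : 1 ≤ g) {i : ℕ} (hi : i ≤ R) : 0 < rowCap g R i := by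
  have : (i : ℤ) ≤ R := by exact_mod_cast hi
  have : (0 : ℤ) ≤ (10 * g + 1) * (R - i) := mul_nonneg (by positivity) (by linarith)
  simp only [rowCap]
  positivity

theorem rowCap_lt (hg : 1 ≤ g) (hR : 1 ≤ R) (i : ℕ) : rowCap g R i < rowSize g R := by
  have h1 : (1 : ℤ) ≤ g := by exact_mod_cast hg
  have h2 : (1 : ℤ) ≤ R := by exact_mod_cast hR
  have h3 : (0 : ℤ) ≤ (10 * g + 1) * i := by positivity
  have h4 : (0 : ℤ) ≤ (g - 1) * R := mul_nonneg (by linarith) (by linarith)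
  simp only [rowCap, rowSize]
  push_cast
  nlinarith

theorem minVal_neg (hg : 1 ≤ g) (hR : 1 ≤ R) (i : ℕ) : minVal g R i < 0 := by
  have h1 : (1 : ℤ) ≤ g := by exact_mod_cast hg
  have h2 : (1 : ℤ) ≤ R := by exact_mod_cast hR
  have h4 : (0 : ℤ) ≤ (g - 1) * R := mul_nonneg (by linarith) (by linarith)
  have h5 : (0 : ℤ) ≤ g * (R - 1) := mul_nonneg (by linarith) (by linarith)
  simp only [minVal]
  nlinarith

/-- The right side is the value when all rows from `i` on are full and every cap is active. Passing
to `i + 1` gains `rowSize` and loses `28 * (g * R)` in suffix capacities and `10 * g + 1` in row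
capacity: a net change of -1, which explains these constants. -/
theorem minVal_eq (i : ℕ) : minVal g R i = suffixCap g R i + suffixCap g R (i + 1) -
    (rowSize g R - rowCap g R i) - (2 * R - (i + 1)) * rowSize g R := by
  simp only [minVal, suffixCap, rowCap, rowSize]; push_cast; ring

theorem le_rowSize_sub_rowCap (hg : 1 ≤ g) (hR : 1 ≤ R) (i : ℕ) :
    2 * (g * R : ℤ) ≤ rowSize g R - rowCap g R i := by
  have h1 : (1 : ℤ) ≤ g := by exact_mod_cast hg
  have h2 : (1 : ℤ) ≤ R := by exact_mod_cast hR
  have h3 : (0 : ℤ) ≤ (10 * g + 1) * i := by positivity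
  have h4 : (0 : ℤ) ≤ (g - 1) * R := mul_nonneg (by linarith) (by linarith)
  simp only [rowCap, rowSize]
  push_cast
  nlinarith

theorem suffixCap_le {i : ℕ} (hi : i ≤ R) : suffixCap g R i ≤ (2 * R - i) * rowSize g R := by
  have h1 : (i : ℤ) ≤ R := by exact_mod_cast hi
  have h2 : (0 : ℤ) ≤ (R - i) * g := mul_nonneg (by linarith) (by positivity)
  have h3 : (0 : ℤ) ≤ (R - i) * (g * R) := mul_nonneg (by linarith) (by positivity)
  have h4 : (0 : ℤ) ≤ R * (g * R) := by positivity
  have h5 : (0 : ℤ) ≤ g * R := by positivity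
  simp only [suffixCap, rowSize]
  push_cast
  linarith

theorem suffixCap_succ_le (hR : 1 ≤ R) {i : ℕ} (hi : i ≤ R) :
    suffixCap g R (i + 1) ≤ (2 * R - i) * rowSize g R - rowSize g R + 2 * (g * R) := by
  have h1 : (i : ℤ) ≤ R := by exact_mod_cast hi
  have h0 : (1 : ℤ) ≤ R := by exact_mod_cast hR
  have h2 : (0 : ℤ) ≤ (2 * R - i - 1) * g := mul_nonneg (by linarith) (by positivity)
  have h3 : (0 : ℤ) ≤ (2 * R - i - 1) * (g * R) := mul_nonneg (by linarith) (by positivity)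
  simp only [suffixCap, rowSize]
  push_cast
  linarith

theorem rowCap_add_le (i : ℕ) (hg : 1 ≤ g) (hi : i + 1 ≤ R) :
    28 * (g * R : ℤ) + (rowSize g R - rowCap g R (i + 1)) ≤ 2 * rowSize g R := by
  have h1 := rowCap_pos hg hi
  have : (28 * (g * R) : ℤ) ≤ rowSize g R := by simp only [rowSize]; push_cast; linarith
  linarith

/-- The largest possible drop of the two nested rank functions below the suffix count. -/
theorem chain_sub_ge (hg : 1 ≤ g) (hR : 1 ≤ R) (hX : ∀ i, X i = x i + X (i + 1))
    (hXr : X (2 * R) = 0) (hxn : ∀ i, x i ≤ rowSize g R) (t : ℕ) : ∀ i, i + t ≤ R →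
    suffixCap g R i - (2 * R - i) * rowSize g R ≤
      (chain (suffixCap g R) (rowCap g R) x X t i).2 - X i ∧
    suffixCap g R (i + 1) - ((2 * R - i) * rowSize g R - rowSize g R) -
        (rowSize g R - rowCap g R i) ≤
      (chain (suffixCap g R) (rowCap g R) x X t i).1 - X i := by
  induction t with
  | zero =>
    intro i hi
    have h1 := sum_le_of_forall_le (i := i) (by omega) hX hXr fun j _ _ => hxn j
    have h2 := suffixCap_le (g := g) (R := R) (i := i) (by omega)
    have h3 := suffixCap_succ_le (g := g) hR (i := i) (by omega)
    have h4 := le_rowSize_sub_rowCap hg hR i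
    simp only [chain]
    refine ⟨?_, by linarith⟩
    rcases min_choice (suffixCap g R i) (X i) with h | h <;> rw [h] <;> linarith
  | succ t ih =>
    intro i hi
    obtain ⟨h1, h2⟩ := ih (i + 1) (by omega)
    have h3 := sum_le_of_forall_le (i := i) (by omega) hX hXr fun j _ _ => hxn j
    have h4 := suffixCap_add_two (g := g) (R := R) i
    have h5 := rowCap_add_le i hg (R := R) (by omega)
    have h6 := le_rowSize_sub_rowCap hg hR i
    have h7 := hX i
    have h8 := hxn i
    have h9 : (0 : ℤ) ≤ g * R := by positivity
    push_cast at h1 h2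
    simp only [chain]
    constructor
    · rcases min_choice (suffixCap g R i)
        (x i + (chain (suffixCap g R) (rowCap g R) x X t (i + 1)).1) with h | h <;> rw [h] <;>
        linarith
    · rcases min_choice (x i) (rowCap g R i) with h | h <;> rw [h] <;> linarith

theorem minVal_succ (i : ℕ) : minVal g R (i + 1) = minVal g R i - 1 := by
  simp only [minVal]; push_cast; ring

/-- Stopping at level `i` costs at least `minVal g R i`, and `minVal` strictly decreases, so the
bound is reached only by descending to the last level. As the row caps are positive, descending for
free forces the rows passed to be empty. The last row must be nonempty, since otherwise its
truncation loss `rowSize - rowCap` is not collected. -/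
theorem minVal_le_excess (hg : 1 ≤ g) (hR : 1 ≤ R) (hX : ∀ i, X i = x i + X (i + 1))
    (hXr : X (2 * R) = 0) (hx0 : ∀ i, 0 ≤ x i) (hX0 : ∀ i, 0 ≤ X i)
    (hxn : ∀ i, x i ≤ rowSize g R) (t : ℕ) :
    ∀ i, i + t ≤ R →
      minVal g R (i + t) + 1 ≤ excess (suffixCap g R) (rowCap g R) x X t i ∧
      (1 ≤ t → excess (suffixCap g R) (rowCap g R) x X t i = minVal g R (i + t) + 1 →
        1 ≤ x (i + t - 1) ∧ (2 ≤ t → x (i + t - 2) = 0)) := by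
  induction t with
  | zero =>
    intro i hi
    refine ⟨?_, by omega⟩
    have h1 := minVal_neg hg hR i
    have h2 := suffixCap_nonneg (g := g) (R := R) (i := i) (by omega)
    have h3 := hX0 i
    simp only [excess, chain, add_zero]
    omega
  | succ t ih =>
    intro i hi
    obtain ⟨h1, h2⟩ := ih (i + 1) (by omega)
    have h3 := (chain_sub_ge hg hR hX hXr hxn (t + 1) i (by omega)).2
    have h4 := minVal_eq (g := g) (R := R) i
    have h5 := rowCap_pos hg (show i ≤ R by omega)
    have h6 := hx0 i
    have e : i + 1 + t = i + (t + 1) := by ring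
    have h7 : minVal g R (i + (t + 1)) + 1 ≤ minVal g R i := by
      simp only [minVal]; push_cast; linarith
    have h8 : minVal g R i ≤
        suffixCap g R i + (chain (suffixCap g R) (rowCap g R) x X (t + 1) i).1 - X i := by
      linarith
    rw [e] at h1 h2
    rw [excess_succ hX]
    refine ⟨by omega, fun _ heq => ?_⟩
    rcases Nat.eq_zero_or_pos t with rfl | ht
    · refine ⟨?_, by omega⟩
      by_contra hlt
      have hx : x i = 0 := by simp only [zero_add, Nat.add_sub_cancel] at hlt; omega
      have h9 := (chain_sub_ge hg hR hX hXr hxn 0 (i + 1) (by omega)).1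
      have h10 := minVal_neg hg hR i
      have h11 := le_rowSize_sub_rowCap hg hR i
      have h12 := suffixCap_nonneg (g := g) (R := R) (i := i + 1) (by omega)
      have h13 := hX0 (i + 1)
      have h14 := hX i
      have h15 := rowCap_lt hg hR i
      rw [zero_add, minVal_succ] at heq
      push_cast at h9
      simp only [excess, chain] at heq h9
      have : min (x i) (rowCap g R i) = 0 := by omega
      rw [this] at heq
      have h16 : minVal g R i + 1 ≤ suffixCap g R i + (min (suffixCap g R (i + 1)) (X (i + 1))) - X i := by
        linarith
      omega
    · have h9 : minVal g R (i + (t + 1)) + 1 < minVal g R i := by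
        have : (1 : ℤ) ≤ t := by exact_mod_cast ht
        simp only [minVal]; push_cast; linarith
      have h10 : excess (suffixCap g R) (rowCap g R) x X t (i + 1) =
        minVal g R (i + (t + 1)) + 1 ∧ x i = 0 := by omega
      obtain ⟨h11, h12⟩ := h2 ht h10.1
      refine ⟨h11, fun _ => ?_⟩
      rcases Nat.lt_or_ge t 2 with ht2 | ht2
      · obtain rfl : t = 1 := by omega
        exact h10.2
      · exact h12 ht2

theorem excess_le_minVal (hX : ∀ i, X i = x i + X (i + 1)) {m : ℕ} (hm : m < R)
    (hx0 : ∀ i < m, x i = 0) (hxm : x m = rowSize g R)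
    (hXm : X (m + 1) = (2 * R - (m + 1)) * rowSize g R) :
    excess (suffixCap g R) (rowCap g R) x X (m + 1) 0 ≤ minVal g R m := by
  have key : ∀ t i, i + t = m →
      excess (suffixCap g R) (rowCap g R) x X (t + 1) i ≤ minVal g R m := by
    intro t
    induction t with
    | zero =>
      intro i hi
      obtain rfl : i = m := by omega
      have h1 := minVal_eq (g := g) (R := R) i
      have h2 := hX i
      rw [excess_succ hX]
      simp only [chain]
      refine (min_le_right _ _).trans ?_
      have h3 := min_le_right (x i) (rowCap g R i)
      have h4 := min_le_left (suffixCap g R (i + 1)) (X (i + 1))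
      linarith
    | succ t ih =>
      intro i hi
      rw [excess_succ hX]
      refine (min_le_left _ _).trans ?_
      have h1 := ih (i + 1) (by omega)
      have h2 := min_le_left (x i) (rowCap g R i)
      have h3 := hx0 i (by omega)
      linarith
  exact key m 0 (by omega)

end Parameters

/-! ### Submodularity of the recursion -/

section Submodular

variable {U : Type} [DecidableEq U]

/-- Monotone submodular set functions. -/
structure IsMonoSubmodular (f : Finset U → ℤ) : Prop where
  mono : ∀ A B : Finset U, A ⊆ B → f A ≤ f B
  submod : IsSubmodular f

theorem IsMonoSubmodular.add {f h : Finset U → ℤ} (hf : IsMonoSubmodular f)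
    (hh : IsMonoSubmodular h) : IsMonoSubmodular fun S => f S + h S where
  mono A B hAB := add_le_add (hf.mono A B hAB) (hh.mono A B hAB)
  submod A B hAB e he := by
    have h1 := hf.submod A B hAB e he
    have h2 := hh.submod A B hAB e he
    show _ + _ - (_ + _) ≤ _ + _ - (_ + _)
    linarith

/-- Truncation preserves submodularity only together with monotonicity, so both are carried through
the recursion. -/
theorem IsMonoSubmodular.const_min {f : Finset U → ℤ} (hf : IsMonoSubmodular f) (k : ℤ) :
    IsMonoSubmodular fun S => min k (f S) where
  mono A B hAB := min_le_min_left k (hf.mono A B hAB)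
  submod A B hAB e he := by
    have h1 := hf.submod A B hAB e he
    have h2 := hf.mono A B hAB
    have h3 := hf.mono _ _ (Finset.insert_subset_insert e hAB)
    have h4 := hf.mono _ _ (Finset.subset_insert e A)
    have h5 := hf.mono _ _ (Finset.subset_insert e B)
    show min _ _ - min _ _ ≤ min _ _ - min _ _
    omega

theorem IsMonoSubmodular.min_const {f : Finset U → ℤ} (hf : IsMonoSubmodular f) (k : ℤ) :
    IsMonoSubmodular fun S => min (f S) k := by
  simpa only [min_comm] using hf.const_min k

/-- Modular functions with nonnegative weights. -/
structure IsMonoModular (f : Finset U → ℤ) : Prop where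
  mono : ∀ A B : Finset U, A ⊆ B → f A ≤ f B
  modular : ∀ A B : Finset U, A ⊆ B → ∀ e : U, e ∉ B → f (insert e B) - f B = f (insert e A) - f A

theorem IsMonoModular.isMonoSubmodular {f : Finset U → ℤ} (hf : IsMonoModular f) :
    IsMonoSubmodular f :=
  ⟨hf.mono, fun A B hAB e he => (hf.modular A B hAB e he).le⟩

theorem isMonoModular_sum {ι : Type*} (s : Finset ι) {f : ι → Finset U → ℤ}
    (hf : ∀ i ∈ s, IsMonoModular (f i)) : IsMonoModular fun S => ∑ i ∈ s, f i S where
  mono A B hAB := Finset.sum_le_sum fun i hi => (hf i hi).mono A B hAB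
  modular A B hAB e he := by
    rw [← Finset.sum_sub_distrib, ← Finset.sum_sub_distrib]
    exact Finset.sum_congr rfl fun i hi => (hf i hi).modular A B hAB e he

theorem isMonoModular_ite_mem (u : U) : IsMonoModular fun S : Finset U => if u ∈ S then (1 : ℤ) else 0 where
  mono A B hAB := by
    have : u ∈ A → u ∈ B := fun h => hAB h
    split_ifs <;> simp_all
  modular A B hAB e he := by
    have h1 : e ∉ A := fun h => he (hAB h)
    by_cases h : u = e
    · subst h; simp [he, h1]
    · simp [Finset.mem_insert, h]

theorem isMonoModular_zero : IsMonoModular fun _ : Finset U => (0 : ℤ) :=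
  ⟨fun _ _ _ => le_rfl, fun _ _ _ _ _ => rfl⟩

theorem chain_isMonoSubmodular {K c : ℕ → ℤ} {x X : ℕ → Finset U → ℤ}
    (hx : ∀ i, IsMonoSubmodular (x i)) (hX : ∀ i, IsMonoSubmodular (X i)) (t : ℕ) : ∀ i,
    IsMonoSubmodular (fun S => (chain K c (x · S) (X · S) t i).1) ∧
    IsMonoSubmodular (fun S => (chain K c (x · S) (X · S) t i).2) := by
  induction t with
  | zero => exact fun i => ⟨hX i, (hX i).const_min _⟩
  | succ t ih =>
    exact fun i => ⟨((hx i).min_const _).add (ih (i + 1)).2,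
      ((hx i).add (ih (i + 1)).1).const_min _⟩

theorem excess_isSubmodular {K c : ℕ → ℤ} {x X : ℕ → Finset U → ℤ}
    (hx : ∀ i, IsMonoModular (x i)) (hX : ∀ i, IsMonoModular (X i)) (t i : ℕ) :
    IsSubmodular fun S => excess K c (x · S) (X · S) t i := by
  intro A B hAB e he
  obtain ⟨h1, h2⟩ := chain_isMonoSubmodular (K := K) (c := c) (fun i => (hx i).isMonoSubmodular)
    (fun i => (hX i).isMonoSubmodular) t i
  have h3 := h1.submod A B hAB e he
  have h4 := h2.submod A B hAB e he
  have h5 := (hX i).modular A B hAB e he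
  simp only [excess]
  linarith

end Submodular

/-! ### Row counts in a column-permuted array -/

section Rows

variable {U : Type} [DecidableEq U] {n r : ℕ}

/-- The number of elements of `S` in the row `i` of the array `p`, when its columns are permuted
by `σ`. -/
def rowCount (p : Fin n → Fin r → U) (σ : Fin n → Equiv.Perm (Fin r)) (S : Finset U) (i : ℕ) : ℤ :=
  if h : i < r then ∑ c, if p c (σ c ⟨i, h⟩) ∈ S then 1 else 0 else 0

/-- The number of elements of `S` in the rows `i, i + 1, …`. -/
def suffixCount (p : Fin n → Fin r → U) (σ : Fin n → Equiv.Perm (Fin r)) (S : Finset U)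
    (i : ℕ) : ℤ :=
  ∑ j ∈ Finset.Ico i r, rowCount p σ S j

variable (p : Fin n → Fin r → U) (σ : Fin n → Equiv.Perm (Fin r)) (S : Finset U)

theorem rowCount_nonneg (i : ℕ) : 0 ≤ rowCount p σ S i := by
  unfold rowCount
  split_ifs
  · exact Finset.sum_nonneg fun c _ => by split_ifs <;> simp
  · exact le_rfl

theorem rowCount_le (i : ℕ) : rowCount p σ S i ≤ n := by
  unfold rowCount
  split_ifs
  · calc _ ≤ ∑ _c : Fin n, (1 : ℤ) := Finset.sum_le_sum fun c _ => by split_ifs <;> simp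
      _ = n := by simp
  · positivity

theorem suffixCount_eq_add (i : ℕ) :
    suffixCount p σ S i = rowCount p σ S i + suffixCount p σ S (i + 1) := by
  unfold suffixCount
  rcases lt_or_ge i r with h | h
  · rw [Finset.sum_eq_sum_Ico_succ_bot h]
  · rw [Finset.Ico_eq_empty (by omega), Finset.Ico_eq_empty (by omega)]
    simp [rowCount, not_lt.2 h]

theorem suffixCount_nonneg (i : ℕ) : 0 ≤ suffixCount p σ S i :=
  Finset.sum_nonneg fun _ _ => rowCount_nonneg p σ S _

theorem suffixCount_self : suffixCount p σ S r = 0 := by simp [suffixCount]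

theorem suffixCount_zero :
    suffixCount p σ S 0 = ∑ c, ∑ j, if p c j ∈ S then (1 : ℤ) else 0 := by
  have h1 : suffixCount p σ S 0 = ∑ j : Fin r, ∑ c, if p c (σ c j) ∈ S then (1 : ℤ) else 0 := by
    rw [suffixCount, ← Finset.range_eq_Ico, Finset.sum_range]
    exact Finset.sum_congr rfl fun j _ => by simp [rowCount]
  rw [h1, Finset.sum_comm]
  exact Finset.sum_congr rfl fun c _ =>
    Equiv.sum_comp (σ c) fun j => if p c j ∈ S then (1 : ℤ) else 0

theorem isMonoModular_rowCount (i : ℕ) : IsMonoModular fun S => rowCount p σ S i := by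
  unfold rowCount
  split_ifs with h
  · exact isMonoModular_sum _ fun c _ => isMonoModular_ite_mem _
  · exact isMonoModular_zero

theorem isMonoModular_suffixCount (i : ℕ) : IsMonoModular fun S => suffixCount p σ S i :=
  isMonoModular_sum _ fun j _ => isMonoModular_rowCount p σ j

theorem rowCount_congr {σ' : Fin n → Equiv.Perm (Fin r)} {m : ℕ}
    (h : ∀ c (i : Fin r), (i : ℕ) < m → σ c i = σ' c i) {i : ℕ} (hi : i < m) :
    rowCount p σ S i = rowCount p σ' S i := by
  unfold rowCount
  split_ifs with hr
  · exact Finset.sum_congr rfl fun c _ => by rw [h c ⟨i, hr⟩ hi]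
  · rfl

/-- The total count does not depend on `σ`, so a suffix count is the total minus the rows before it.
-/
theorem suffixCount_congr {σ' : Fin n → Equiv.Perm (Fin r)} {m : ℕ}
    (h : ∀ c (i : Fin r), (i : ℕ) < m → σ c i = σ' c i) (i : ℕ) : i ≤ m →
    suffixCount p σ S i = suffixCount p σ' S i := by
  induction i with
  | zero => intro _; rw [suffixCount_zero, suffixCount_zero]
  | succ i ih =>
    intro hi
    have h1 := suffixCount_eq_add p σ S i
    have h2 := suffixCount_eq_add p σ' S i
    have h3 := rowCount_congr p σ S h (show i < m by omega)
    have h4 := ih (by omega)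
    linarith

theorem suffixCount_zero_le [Fintype U] (hp : Function.Injective fun a : Fin n × Fin r => p a.1 a.2) :
    suffixCount p σ S 0 ≤ Fintype.card U := by
  rw [suffixCount_zero, ← Finset.sum_product']
  calc _ ≤ ∑ _a : Fin n × Fin r, (1 : ℤ) := Finset.sum_le_sum fun c _ => by split_ifs <;> simp
    _ = (Fintype.card (Fin n × Fin r) : ℤ) := by simp
    _ ≤ _ := by exact_mod_cast Fintype.card_le_of_injective _ hp

/-- The union of the rows `m, m + 1, …`. -/
def suffixRows (m : ℕ) : Finset U :=
  (Finset.univ.filter fun a : Fin n × Fin r => m ≤ (a.2 : ℕ)).image fun a => p a.1 (σ a.1 a.2)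

theorem mem_suffixRows (hp : Function.Injective fun a : Fin n × Fin r => p a.1 a.2) (m : ℕ)
    (c : Fin n) (i : Fin r) : p c (σ c i) ∈ suffixRows p σ m ↔ m ≤ i := by
  simp only [suffixRows, Finset.mem_image, Finset.mem_filter, Finset.mem_univ, true_and]
  constructor
  · rintro ⟨⟨c', i'⟩, h1, h2⟩
    have h3 := @hp (c', σ c' i') (c, σ c i) h2
    simp only [Prod.mk.injEq] at h3
    obtain ⟨rfl, h4⟩ := h3
    rwa [← (σ c').injective h4]
  · exact fun h => ⟨(c, i), h, rfl⟩

theorem rowCount_suffixRows (hp : Function.Injective fun a : Fin n × Fin r => p a.1 a.2) (m i : ℕ) :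
    rowCount p σ (suffixRows p σ m) i = if m ≤ i ∧ i < r then (n : ℤ) else 0 := by
  unfold rowCount
  by_cases hr : i < r
  · simp only [hr, dif_pos, mem_suffixRows p σ hp, and_true]
    split_ifs <;> simp
  · simp [hr]

theorem suffixCount_suffixRows (hp : Function.Injective fun a : Fin n × Fin r => p a.1 a.2)
    {m i : ℕ} (hmi : m ≤ i) (hir : i ≤ r) :
    suffixCount p σ (suffixRows p σ m) i = (r - i) * n := by
  unfold suffixCount
  rw [Finset.sum_congr rfl (g := fun _ => (n : ℤ))]
  · simp [Nat.cast_sub hir]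
  · intro j hj
    rw [Finset.mem_Ico] at hj
    rw [rowCount_suffixRows p σ hp, if_pos ⟨by omega, hj.2⟩]

end Rows

/-! ### The hard instances and their minima -/

section Instances

variable {N g R : ℕ}

/-- The hard function with `m` levels. -/
def hardFun (p : Fin (rowSize g R) → Fin (2 * R) → Fin N)
    (σ : Fin (rowSize g R) → Equiv.Perm (Fin (2 * R))) (m : ℕ) (S : Finset (Fin N)) : ℤ :=
  excess (suffixCap g R) (rowCap g R) (rowCount p σ S) (suffixCount p σ S) m 0

variable {p : Fin (rowSize g R) → Fin (2 * R) → Fin N}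

theorem hardFun_isInstance (hp : Function.Injective fun a : Fin _ × Fin _ => p a.1 a.2)
    (σ : Fin (rowSize g R) → Equiv.Perm (Fin (2 * R))) {m : ℕ}
    (hg : 1 ≤ g) (hm : m ≤ R) : IsInstance (hardFun p σ m) := by
  refine ⟨excess_isSubmodular (isMonoModular_rowCount p σ) (isMonoModular_suffixCount p σ) m 0,
    fun S => ?_⟩
  have h1 := chain_bounds (m := R) (K := suffixCap g R) (c := rowCap g R)
    (fun i (hi : i ≤ R) => suffixCap_nonneg (g := g) (hi.trans (by omega)))
    (fun i hi => (rowCap_pos hg hi).le) (rowCount_nonneg p σ S) (suffixCount_eq_add p σ S)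
    (suffixCount_nonneg p σ S) m 0 (by omega)
  have h2 := suffixCount_zero_le p σ S hp
  rw [Fintype.card_fin] at h2
  simp only [Set.mem_Icc, hardFun, excess]
  omega

theorem hardFun_congr {σ σ' : Fin (rowSize g R) → Equiv.Perm (Fin (2 * R))} {m : ℕ}
    (h : ∀ c (i : Fin (2 * R)), (i : ℕ) < m → σ c i = σ' c i) : hardFun p σ m = hardFun p σ' m := by
  funext S
  have h1 := suffixCount_congr p σ S h
  unfold hardFun excess
  rw [chain_congr (m := m) (fun i hi => rowCount_congr p σ S h hi) h1 m 0 (by omega),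
    h1 0 (by omega)]

theorem hardFun_eq_of_balanced (σ : Fin (rowSize g R) → Equiv.Perm (Fin (2 * R)))
    {S : Finset (Fin N)} {k j : ℕ} (hb : Balanced (rowCount p σ S) g (2 * R) k)
    (hkj : k + 1 ≤ j) (hj : j ≤ R) : hardFun p σ j S = hardFun p σ (k + 1) S := by
  unfold hardFun excess
  rw [chain_eq_of_balanced (suffixCount_eq_add p σ S) (suffixCount_self p σ S) hb hkj hj]

theorem minVal_le_hardFun (hg : 1 ≤ g) (σ : Fin (rowSize g R) → Equiv.Perm (Fin (2 * R)))
    {m : ℕ} (hm : m < R) (S : Finset (Fin N)) :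
    minVal g R m ≤ hardFun p σ (m + 1) S ∧ (hardFun p σ (m + 1) S = minVal g R m →
      1 ≤ rowCount p σ S m ∧ (1 ≤ m → rowCount p σ S (m - 1) = 0)) := by
  have h := minVal_le_excess hg (by omega) (suffixCount_eq_add p σ S) (suffixCount_self p σ S)
    (rowCount_nonneg p σ S) (suffixCount_nonneg p σ S) (rowCount_le p σ S) (m + 1) 0 (by omega)
  rw [zero_add, minVal_succ, sub_add_cancel] at h
  exact ⟨h.1, fun h' => ⟨(h.2 (by omega) h').1, fun hm => (h.2 (by omega) h').2 (by omega)⟩⟩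

theorem exists_hardFun_le (hp : Function.Injective fun a : Fin _ × Fin _ => p a.1 a.2)
    (σ : Fin (rowSize g R) → Equiv.Perm (Fin (2 * R))) {m : ℕ} (hm : m < R) :
    ∃ S, hardFun p σ (m + 1) S ≤ minVal g R m := by
  refine ⟨suffixRows p σ m, excess_le_minVal (suffixCount_eq_add p σ _) hm ?_ ?_ ?_⟩
  · intro i hi
    rw [rowCount_suffixRows p σ hp, if_neg (by omega)]
  · rw [rowCount_suffixRows p σ hp, if_pos (by omega)]
  · rw [suffixCount_suffixRows p σ hp (by omega) (by omega)]
    push_cast; ring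

theorem eq_minVal_of_isMinValue (hg : 1 ≤ g)
    (hp : Function.Injective fun a : Fin _ × Fin _ => p a.1 a.2)
    (σ : Fin (rowSize g R) → Equiv.Perm (Fin (2 * R))) {m : ℕ} (hm : m < R) {v : ℤ}
    (hv : IsMinValue (hardFun p σ (m + 1)) v) : v = minVal g R m := by
  obtain ⟨⟨S, rfl⟩, h⟩ := hv
  obtain ⟨T, hT⟩ := exists_hardFun_le hp σ hm
  exact le_antisymm ((h ⟨T, rfl⟩).trans hT) (minVal_le_hardFun hg σ hm S).1

theorem not_isMinValue_both (hg : 1 ≤ g)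
    (hp : Function.Injective fun a : Fin _ × Fin _ => p a.1 a.2)
    (σ : Fin (rowSize g R) → Equiv.Perm (Fin (2 * R))) {m : ℕ} (hm : m + 1 < R) (v : ℤ) :
    ¬(IsMinValue (hardFun p σ (m + 1)) v ∧ IsMinValue (hardFun p σ (m + 2)) v) := by
  rintro ⟨h1, h2⟩
  have h3 := eq_minVal_of_isMinValue hg hp σ (by omega) h1
  have h4 := eq_minVal_of_isMinValue hg hp σ hm h2
  rw [minVal_succ] at h4
  omega

theorem IsMinimizer.isMinValue {U : Type} {f : Finset U → ℤ} {S : Finset U} (h : IsMinimizer f S) :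
    IsMinValue f (f S) :=
  ⟨⟨S, rfl⟩, by rintro _ ⟨T, rfl⟩; exact h T⟩

/-- A minimizer for `m + 1` levels meets row `m`, while one for `m + 2` levels avoids it. -/
theorem not_isMinimizer_both (hg : 1 ≤ g)
    (hp : Function.Injective fun a : Fin _ × Fin _ => p a.1 a.2)
    (σ : Fin (rowSize g R) → Equiv.Perm (Fin (2 * R))) {m : ℕ} (hm : m + 1 < R)
    (S : Finset (Fin N)) :
    ¬(IsMinimizer (hardFun p σ (m + 1)) S ∧ IsMinimizer (hardFun p σ (m + 2)) S) := by
  rintro ⟨h1, h2⟩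
  have h3 := eq_minVal_of_isMinValue hg hp σ (by omega) h1.isMinValue
  have h4 := eq_minVal_of_isMinValue hg hp σ hm h2.isMinValue
  have h5 := ((minVal_le_hardFun hg σ (by omega) S).2 h3).1
  have h6 := ((minVal_le_hardFun hg σ hm S).2 h4).2 (by omega)
  simp only [Nat.add_sub_cancel] at h6
  omega

end Instances

/-! ### Concentration of signed sums -/

section Tail

open Real

theorem exp_add_exp_neg_le {a l : ℝ} (ha : |a| ≤ 1) :
    exp (l * a) + exp (l * -a) ≤ 2 * exp (l ^ 2 / 2) := by
  have h1 : exp (l * a) + exp (l * -a) = 2 * cosh (l * a) := by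
    rw [cosh_eq, mul_neg]; ring
  have h2 : (l * a) ^ 2 ≤ l ^ 2 := by
    rw [mul_pow]
    exact mul_le_of_le_one_right (sq_nonneg l) ((sq_le_one_iff_abs_le_one a).2 ha)
  rw [h1]
  have h3 := (cosh_le_exp_half_sq (l * a)).trans (exp_le_exp.2 (by linarith : _ ≤ l ^ 2 / 2))
  linarith

/-- Hoeffding's inequality for signed sums. -/
theorem card_signed_sum_ge_le {n : ℕ} (hn : 0 < n) (a : Fin n → ℝ) (ha : ∀ c, |a c| ≤ 1) {b : ℝ}
    (hb : 0 ≤ b) :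
    ((Finset.univ.filter fun ε : Fin n → Bool => b ≤ ∑ c, if ε c then a c else -a c).card : ℝ) ≤
      2 ^ n * exp (-(b ^ 2 / (2 * n))) := by
  have hn' : (0 : ℝ) < n := by exact_mod_cast hn
  -- The minimizer of the exponent `n * l ^ 2 / 2 - l * b` in the Chernoff bound.
  set l : ℝ := b / n with hl
  have hl0 : 0 ≤ l := by positivity
  have h1 : ∑ ε : Fin n → Bool, exp (l * ∑ c, if ε c then a c else -a c) ≤
      2 ^ n * exp (n * (l ^ 2 / 2)) := by
    calc _ = ∑ ε : Fin n → Bool, ∏ c, exp (l * if ε c then a c else -a c) := by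
          simp_rw [Finset.mul_sum, exp_sum]
      _ = ∏ c, ∑ e : Bool, exp (l * if e then a c else -a c) :=
          (Fintype.prod_sum fun c (e : Bool) => exp (l * if e then a c else -a c)).symm
      _ ≤ ∏ _c : Fin n, (2 * exp (l ^ 2 / 2)) := by
          refine Finset.prod_le_prod (fun c _ => by positivity) fun c _ => ?_
          simpa using exp_add_exp_neg_le (ha c)
      _ = _ := by simp [mul_pow, ← exp_nat_mul]
  have h2 : ((Finset.univ.filter fun ε : Fin n → Bool =>
      b ≤ ∑ c, if ε c then a c else -a c).card : ℝ) * exp (l * b) ≤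
      ∑ ε : Fin n → Bool, exp (l * ∑ c, if ε c then a c else -a c) := by
    rw [← nsmul_eq_mul, ← Finset.sum_const]
    refine (Finset.sum_le_sum fun ε hε => ?_).trans
      (Finset.sum_le_sum_of_subset_of_nonneg (Finset.filter_subset _ _) fun _ _ _ => by positivity)
    exact exp_le_exp.2 (mul_le_mul_of_nonneg_left (Finset.mem_filter.1 hε).2 hl0)
  have h3 : exp (-(b ^ 2 / (2 * n))) = exp (n * (l ^ 2 / 2)) / exp (l * b) := by
    rw [← exp_sub, hl]
    congr 1
    field_simp
    ring
  rw [h3, ← mul_div_assoc, le_div_iff₀ (by positivity)]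
  exact h2.trans h1

end Tail

/-! ### Unbalanced queries are rare -/

section Counting

variable {U : Type} [DecidableEq U] {n r : ℕ}

/-- The column permutations that swap the rows `j` and `l` in the columns selected by `ε`. -/
def columnSwap (j l : Fin r) (ε : Fin n → Bool) : Fin n → Equiv.Perm (Fin r) :=
  fun c => if ε c then 1 else Equiv.swap j l

theorem rowCount_sub_mul_columnSwap (p : Fin n → Fin r → U) (σ : Fin n → Equiv.Perm (Fin r))
    (S : Finset U) (j l : Fin r) (ε : Fin n → Bool) :
    ((rowCount p (σ * columnSwap j l ε) S j - rowCount p (σ * columnSwap j l ε) S l : ℤ) : ℝ) =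
      ∑ c, if ε c then ((if p c (σ c j) ∈ S then 1 else 0) - (if p c (σ c l) ∈ S then 1 else 0) : ℝ)
        else -((if p c (σ c j) ∈ S then 1 else 0) - (if p c (σ c l) ∈ S then 1 else 0)) := by
  simp only [rowCount, j.2, l.2, dif_pos, Fin.eta, ← Finset.sum_sub_distrib]
  push_cast
  refine Finset.sum_congr rfl fun c _ => ?_
  by_cases h : ε c <;> simp [columnSwap, h]

/-- Randomly swapping rows `j` and `l` in each column leaves the uniform law of `σ` and the query
set unchanged, and turns the difference of the two row counts into a signed sum with independent
signs. Hoeffding and a union bound over the queries apply for each fixed `σ`; double counting over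
`σ` and `ε` concludes. -/
theorem card_exists_unbalanced_le (hn : 0 < n) (p : Fin n → Fin r → U) (j l : Fin r) {q b : ℝ}
    (hb : 0 ≤ b)     (Q : (Fin n → Equiv.Perm (Fin r)) → Finset (Finset U))
    (hQ : ∀ σ ε, Q (σ * columnSwap j l ε) = Q σ) (hq : ∀ σ, ((Q σ).card : ℝ) ≤ q) :
    ((Finset.univ.filter fun σ : Fin n → Equiv.Perm (Fin r) =>
      ∃ S ∈ Q σ, b ≤ ((rowCount p σ S j - rowCount p σ S l : ℤ) : ℝ)).card : ℝ) ≤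
      q * Real.exp (-(b ^ 2 / (2 * n))) * Fintype.card (Fin n → Equiv.Perm (Fin r)) := by
  classical
  set bad : (Fin n → Equiv.Perm (Fin r)) → Prop := fun σ =>
    ∃ S ∈ Q σ, b ≤ ((rowCount p σ S j - rowCount p σ S l : ℤ) : ℝ) with hbad
  have h1 : ∀ σ, ((Finset.univ.filter fun ε : Fin n → Bool => bad (σ * columnSwap j l ε)).card : ℝ) ≤
      q * (2 ^ n * Real.exp (-(b ^ 2 / (2 * n)))) := by
    intro σ
    set a : Finset U → Fin n → ℝ := fun S c =>
      (if p c (σ c j) ∈ S then 1 else 0) - (if p c (σ c l) ∈ S then 1 else 0) with ha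
    have ha1 : ∀ S c, |a S c| ≤ 1 := fun S c => by
      simp only [ha]; split_ifs <;> simp
    set T : Finset U → Finset (Fin n → Bool) := fun S =>
      Finset.univ.filter fun ε => b ≤ ∑ c, if ε c then a S c else -a S c with hT
    have hsub : (Finset.univ.filter fun ε : Fin n → Bool => bad (σ * columnSwap j l ε)) ⊆
        (Q σ).biUnion T := by
      intro ε hε
      obtain ⟨S, hS, h⟩ := (Finset.mem_filter.1 hε).2
      rw [hQ] at hS
      rw [rowCount_sub_mul_columnSwap] at h
      exact Finset.mem_biUnion.2 ⟨S, hS, Finset.mem_filter.2 ⟨Finset.mem_univ _, h⟩⟩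
    calc _ ≤ (((Q σ).biUnion T).card : ℝ) := Nat.cast_le.2 (Finset.card_le_card hsub)
      _ ≤ ∑ S ∈ Q σ, ((T S).card : ℝ) :=
          (Nat.cast_le.2 Finset.card_biUnion_le).trans_eq (Nat.cast_sum _ _)
      _ ≤ ∑ S ∈ Q σ, (2 ^ n * Real.exp (-(b ^ 2 / (2 * n)))) :=
          Finset.sum_le_sum fun S _ => card_signed_sum_ge_le hn (a S) (ha1 S) hb
      _ = (Q σ).card * (2 ^ n * Real.exp (-(b ^ 2 / (2 * n)))) := by simp
      _ ≤ _ := mul_le_mul_of_nonneg_right (hq σ) (by positivity)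
  have h2 : ∀ ε : Fin n → Bool, (Finset.univ.filter fun σ => bad (σ * columnSwap j l ε)).card =
      (Finset.univ.filter bad).card := by
    intro ε
    refine Finset.card_equiv (Equiv.mulRight (columnSwap j l ε)) fun σ => ?_
    simp
  have h3 : (2 ^ n : ℝ) * (Finset.univ.filter bad).card =
      ∑ σ, ((Finset.univ.filter fun ε : Fin n → Bool => bad (σ * columnSwap j l ε)).card : ℝ) := by
    have h4 : ∑ ε : Fin n → Bool, ((Finset.univ.filter fun σ => bad (σ * columnSwap j l ε)).card : ℝ) =
        (2 ^ n : ℝ) * (Finset.univ.filter bad).card := by simp [h2]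
    rw [← h4]
    simp only [Finset.card_filter]
    push_cast
    exact Finset.sum_comm
  have h5 := Finset.sum_le_sum fun σ (_ : σ ∈ Finset.univ) => h1 σ
  rw [← h3, Finset.sum_const, nsmul_eq_mul, Finset.card_univ] at h5
  have h6 : (0 : ℝ) < 2 ^ n := by positivity
  refine le_of_mul_le_mul_left (h5.trans_eq ?_) h6
  ring

end Counting

/-! ### Transcripts and averaging over the seed -/

section Algorithms

variable {U : Type} [DecidableEq U] {α : Type}

/-- If the answers in round `k` are the same for all functions `F j` with `k < j`, then the first
`k` rounds do not distinguish the functions `F j` with `k ≤ j`. -/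
theorem Algorithm.transcript_eq (A : Algorithm U α) (F : ℕ → Finset U → ℤ) {R k : ℕ}
    (h : ∀ i < k, ∀ S ∈ A.queriesInRound (F i) i, ∀ j, i + 1 ≤ j → j ≤ R →
      F j S = F (i + 1) S) (j : ℕ) (hkj : k ≤ j) (hjR : j ≤ R) :
    A.transcript (F j) k = A.transcript (F k) k := by
  induction k generalizing j with
  | zero => rfl
  | succ k ih =>
    have ih' := ih fun i hi => h i (by omega)
    have key : ∀ j, k + 1 ≤ j → j ≤ R → A.transcript (F j) (k + 1) = A.transcript (F k) k ++
        [(A.query (A.transcript (F k) k)).image fun S => (S, F (k + 1) S)] := by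
      intro j hj hjR
      rw [Algorithm.transcript, ih' j (by omega) hjR]
      congr 2
      refine Finset.image_congr fun S hS => ?_
      rw [h k (by omega) S hS j hj hjR]
    rw [key j hkj hjR, key (k + 1) le_rfl (by omega)]

/-- A randomized algorithm errs on one of two families of instances without common correct
outputs, if for every seed it distinguishes fewer than a third of the pairs. -/
theorem RandomizedAlgorithm.not_succeedsWithProb {N s : ℕ} {α : Type} {ι : Type} [Fintype ι]
    (A : RandomizedAlgorithm.{u} (Fin N) α s) {correct : (Finset (Fin N) → ℤ) → α → Prop}
    {f h : ι → Finset (Fin N) → ℤ} (hf : ∀ i, IsInstance (f i)) (hh : ∀ i, IsInstance (h i))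
    (hc : ∀ i v, ¬(correct (f i) v ∧ correct (h i) v))
    (hcard : ∀ ω, 3 * Nat.card {i // (A.alg ω).transcript (f i) s ≠ (A.alg ω).transcript (h i) s} <
      Fintype.card ι) : ¬A.SucceedsWithProb correct (2 / 3) := by
  classical
  intro hA
  set E : ι → Set A.Ω := fun i => {ω | correct (f i) ((A.alg ω).run s (f i))} ∩
    {ω | correct (h i) ((A.alg ω).run s (h i))} with hE
  have hmeas : ∀ g : Finset (Fin N) → ℤ, MeasurableSet {ω | correct g ((A.alg ω).run s g)} :=
    fun g => A.measurable_run g (t := {v | correct g v}) trivial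
  have hEm : ∀ i, MeasurableSet (E i) := fun i => (hmeas _).inter (hmeas _)
  have h1 : ∀ i, (1 / 3 : ℝ) ≤ A.μ.real (E i) := by
    intro i
    have h2 := measureReal_union_add_inter (μ := A.μ)
      (s := {ω | correct (f i) ((A.alg ω).run s (f i))}) (hmeas (h i))
    have h3 := hA (f i) (hf i)
    have h4 := hA (h i) (hh i)
    have h5 : A.μ.real ({ω | correct (f i) ((A.alg ω).run s (f i))} ∪
      {ω | correct (h i) ((A.alg ω).run s (h i))}) ≤ 1 := measureReal_le_one
    simp only [hE]
    linarith
  -- A seed correct on both members of a pair must distinguish them, since equal transcripts give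
  -- equal outputs. Integrality of `hcard` supplies the `- 1`, contradicting the mean of at least `1
  -- / 3` per pair.
  have h2 : ∀ ω, ∑ i, (E i).indicator (1 : A.Ω → ℝ) ω ≤ (Fintype.card ι - 1) / 3 := by
    intro ω
    have h3 : ∑ i, (E i).indicator (1 : A.Ω → ℝ) ω ≤
        (Nat.card {i // (A.alg ω).transcript (f i) s ≠ (A.alg ω).transcript (h i) s} : ℝ) := by
      rw [Nat.card_eq_fintype_card, Fintype.card_subtype, Finset.card_filter]
      push_cast
      refine Finset.sum_le_sum fun i _ => ?_
      by_cases hi : ω ∈ E i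
      · have : (A.alg ω).transcript (f i) s ≠ (A.alg ω).transcript (h i) s := by
          intro heq
          refine hc i _ ⟨hi.1, ?_⟩
          have := hi.2
          simp only [Set.mem_ofPred_eq, Algorithm.run, ← heq] at this
          exact this
        simp [hi, this]
      · simp only [Set.indicator_of_notMem hi]
        split_ifs <;> simp
    have h4 : (3 * Nat.card {i // (A.alg ω).transcript (f i) s ≠ (A.alg ω).transcript (h i) s} + 1 : ℝ) ≤
      Fintype.card ι := by exact_mod_cast hcard ω
    linarith
  have hint : ∀ i, Integrable ((E i).indicator (1 : A.Ω → ℝ)) A.μ := fun i =>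
    (integrable_const (1 : ℝ)).indicator (hEm i)
  have h3 : ∫ ω, ∑ i, (E i).indicator (1 : A.Ω → ℝ) ω ∂A.μ = ∑ i, A.μ.real (E i) := by
    rw [integral_finsetSum _ fun i _ => hint i]
    exact Finset.sum_congr rfl fun i _ => integral_indicator_one (hEm i)
  have h4 : ∫ ω, ∑ i, (E i).indicator (1 : A.Ω → ℝ) ω ∂A.μ ≤ (Fintype.card ι - 1) / 3 := by
    have := integral_mono (integrable_finsetSum _ fun i _ => hint i) (integrable_const _) h2
    simpa using this
  have h5 : ∑ _i : ι, (1 / 3 : ℝ) ≤ ∑ i, A.μ.real (E i) := Finset.sum_le_sum fun i _ => h1 i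
  simp only [Finset.sum_const, Finset.card_univ, nsmul_eq_mul] at h5
  linarith

end Algorithms

/-! ### Few rounds do not distinguish consecutive numbers of levels -/

section Distinguish

variable {N g m : ℕ} {α : Type}

/-- A deterministic algorithm with at most `m + 1` rounds distinguishes the hard functions with
`m + 1` and `m + 2` levels for few permutations. -/
theorem card_distinguished_le (hg : 1 ≤ g) {s : ℕ} (hs : s ≤ m + 1)
    (p : Fin (rowSize g (m + 2)) → Fin (2 * (m + 2)) → Fin N) (A : Algorithm (Fin N) α) {q : ℝ}
    (hq : ∀ σ, ∀ k < s, ((A.queriesInRound (hardFun p σ k) k).card : ℝ) ≤ q) :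
    (Nat.card {σ // A.transcript (hardFun p σ (m + 1)) s ≠
        A.transcript (hardFun p σ (m + 2)) s} : ℝ) ≤
      s * (2 * (m + 2)) ^ 2 * (q * Real.exp (-((g : ℝ) ^ 2 / (2 * rowSize g (m + 2)))) *
        Fintype.card (Fin (rowSize g (m + 2)) → Equiv.Perm (Fin (2 * (m + 2))))) := by
  classical
  rcases Nat.eq_zero_or_pos s with rfl | hs0
  · simp [Algorithm.transcript]
  have hq0 : 0 ≤ q := (Nat.cast_nonneg _).trans (hq 1 0 hs0)
  have hn : 0 < rowSize g (m + 2) := by unfold rowSize; omega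
  set bad : ℕ → Fin (2 * (m + 2)) → Fin (2 * (m + 2)) →
      Finset (Fin (rowSize g (m + 2)) → Equiv.Perm (Fin (2 * (m + 2)))) := fun k j l =>
    Finset.univ.filter fun σ => (k ≤ j ∧ k ≤ l) ∧ ∃ S ∈ A.queriesInRound (hardFun p σ k) k,
      (g : ℝ) ≤ ((rowCount p σ S j - rowCount p σ S l : ℤ) : ℝ) with hbad
  set C : ℝ := q * Real.exp (-((g : ℝ) ^ 2 / (2 * rowSize g (m + 2)))) *
        Fintype.card (Fin (rowSize g (m + 2)) → Equiv.Perm (Fin (2 * (m + 2)))) with hC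
  have hC0 : 0 ≤ C := by positivity
  have h1 : ∀ k < s, ∀ j l, ((bad k j l).card : ℝ) ≤ C := by
    intro k hk j l
    by_cases hkjl : k ≤ j ∧ k ≤ l
    · have := card_exists_unbalanced_le hn p j l (Nat.cast_nonneg g)
        (fun σ => A.queriesInRound (hardFun p σ k) k) (fun σ ε => ?_) (fun σ => hq σ k hk)
      · simpa only [hbad, hkjl, and_self, true_and] using this
      -- The swap moves only rows with index at least `k`, which the function with `k` levels does
      -- not see.
      · refine congrArg (fun f => A.queriesInRound f k) (hardFun_congr fun c i hi => ?_)
        have h2 : i ≠ j := by rintro rfl; omega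
        have h3 : i ≠ l := by rintro rfl; omega
        simp only [Pi.mul_apply, Equiv.Perm.mul_apply, columnSwap]
        split_ifs
        · simp
        · rw [Equiv.swap_apply_of_ne_of_ne h2 h3]
    · simp only [hbad, hkjl, false_and, Finset.filter_false, Finset.card_empty, Nat.cast_zero]
      exact hC0
  have h2 : (Finset.univ.filter fun σ => A.transcript (hardFun p σ (m + 1)) s ≠
      A.transcript (hardFun p σ (m + 2)) s) ⊆
      (Finset.range s).biUnion fun k => (Finset.univ ×ˢ Finset.univ).biUnion fun a => bad k a.1 a.2 := by
    intro σ hσ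
    by_contra hnot
    refine (Finset.mem_filter.1 hσ).2 ?_
    have hF : ∀ i < s, ∀ S ∈ A.queriesInRound (hardFun p σ i) i, ∀ j, i + 1 ≤ j → j ≤ m + 2 →
        hardFun p σ j S = hardFun p σ (i + 1) S := by
      intro i hi S hS j hij hj
      refine hardFun_eq_of_balanced σ (fun a b ha ha' hb hb' => ?_) hij hj
      by_contra hlt
      refine hnot (Finset.mem_biUnion.2 ⟨i, Finset.mem_range.2 hi, Finset.mem_biUnion.2
        ⟨(⟨a, ha'⟩, ⟨b, hb'⟩), by simp, Finset.mem_filter.2 ⟨Finset.mem_univ _, ⟨ha, hb⟩, S, hS, ?_⟩⟩⟩)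
      exact_mod_cast (not_le.1 hlt).le
    rw [A.transcript_eq (hardFun p σ) hF (m + 1) hs (by omega),
      A.transcript_eq (hardFun p σ) hF (m + 2) (by omega) le_rfl]
  rw [Nat.card_eq_fintype_card, Fintype.card_subtype]
  calc _ ≤ (((Finset.range s).biUnion fun k =>
        (Finset.univ ×ˢ Finset.univ).biUnion fun a => bad k a.1 a.2).card : ℝ) :=
        Nat.cast_le.2 (Finset.card_le_card h2)
    _ ≤ ∑ k ∈ Finset.range s, ∑ a ∈ Finset.univ ×ˢ Finset.univ, ((bad k a.1 a.2).card : ℝ) := by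
        refine (Nat.cast_le.2 Finset.card_biUnion_le).trans ?_
        rw [Nat.cast_sum]
        refine Finset.sum_le_sum fun k _ => (Nat.cast_le.2 Finset.card_biUnion_le).trans ?_
        rw [Nat.cast_sum]
    _ ≤ ∑ k ∈ Finset.range s, ∑ a ∈ (Finset.univ : Finset (Fin (2 * (m + 2)))) ×ˢ
        (Finset.univ : Finset (Fin (2 * (m + 2)))), C :=
        Finset.sum_le_sum fun k hk => Finset.sum_le_sum fun a _ =>
          h1 k (Finset.mem_range.1 hk) a.1 a.2
    _ = _ := by
        simp only [Finset.sum_const, Finset.card_product, Finset.card_univ, Fintype.card_fin,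
          Finset.card_range, nsmul_eq_mul]
        push_cast
        ring

theorem RandomizedAlgorithm.not_succeedsWithProb_of_few_rounds (hg : 1 ≤ g) {s : ℕ}
    (hs : s ≤ m + 1) (hN : rowSize g (m + 2) * (2 * (m + 2)) ≤ N) {q : ℝ}
    (hq : 3 * (s * (2 * (m + 2)) ^ 2 *
      (q * Real.exp (-((g : ℝ) ^ 2 / (2 * rowSize g (m + 2)))))) < 1)
    (A : RandomizedAlgorithm.{u} (Fin N) α s) (hA : A.MakesAtMost q)
    {correct : (Finset (Fin N) → ℤ) → α → Prop}
    (hc : ∀ (p : Fin (rowSize g (m + 2)) → Fin (2 * (m + 2)) → Fin N) σ v,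
      Function.Injective (fun a : Fin _ × Fin _ => p a.1 a.2) →
      ¬(correct (hardFun p σ (m + 1)) v ∧ correct (hardFun p σ (m + 2)) v)) :
    ¬A.SucceedsWithProb correct (2 / 3) := by
  obtain ⟨e⟩ : Nonempty (Fin (rowSize g (m + 2)) × Fin (2 * (m + 2)) ↪ Fin N) :=
    Function.Embedding.nonempty_of_card_le (by simpa using hN)
  set p : Fin (rowSize g (m + 2)) → Fin (2 * (m + 2)) → Fin N := fun c j => e (c, j) with hp
  have hpi : Function.Injective fun a : Fin _ × Fin _ => p a.1 a.2 := e.injective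
  refine A.not_succeedsWithProb (f := fun σ => hardFun p σ (m + 1))
    (h := fun σ => hardFun p σ (m + 2)) (fun σ => hardFun_isInstance hpi σ hg (by omega))
    (fun σ => hardFun_isInstance hpi σ hg le_rfl) (fun σ v => hc p σ v hpi) fun ω => ?_
  have h1 := card_distinguished_le hg hs p (A.alg ω) (q := q) fun σ k hk =>
    hA _ (hardFun_isInstance hpi σ hg (by omega)) ω k hk
  have h2 : (0 : ℝ) < Fintype.card (Fin (rowSize g (m + 2)) → Equiv.Perm (Fin (2 * (m + 2)))) := by
    exact_mod_cast Fintype.card_pos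
  have h3 := mul_lt_mul_of_pos_right hq h2
  have : (3 * Nat.card {σ // (A.alg ω).transcript (hardFun p σ (m + 1)) s ≠
      (A.alg ω).transcript (hardFun p σ (m + 2)) s} : ℝ) <
      Fintype.card (Fin (rowSize g (m + 2)) → Equiv.Perm (Fin (2 * (m + 2)))) := by
    linarith
  exact_mod_cast this

end Distinguish

/-! ### At least one round is needed -/

section NoRounds

variable {N : ℕ} {α : Type}

theorem isInstance_card : IsInstance fun S : Finset (Fin N) => (S.card : ℤ) := by
  refine ⟨fun A B hAB e he => ?_, fun S => ?_⟩
  · beta_reduce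
    rw [Finset.card_insert_of_notMem he, Finset.card_insert_of_notMem fun h => he (hAB h)]
    push_cast; linarith
  · have := S.card_le_univ
    rw [Fintype.card_fin] at this
    constructor <;> beta_reduce <;> omega

theorem isInstance_neg_card : IsInstance fun S : Finset (Fin N) => -(S.card : ℤ) := by
  refine ⟨fun A B hAB e he => ?_, fun S => ?_⟩
  · beta_reduce
    rw [Finset.card_insert_of_notMem he, Finset.card_insert_of_notMem fun h => he (hAB h)]
    push_cast; linarith
  · have := S.card_le_univ
    rw [Fintype.card_fin] at this
    constructor <;> beta_reduce <;> omega

/-- Covers the range where the claimed bound is below 1; with `1 ≤ s` the choice of parameters may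
assume that `N / (c * log N)` is large. -/
theorem RandomizedAlgorithm.rounds_pos {s : ℕ} (A : RandomizedAlgorithm.{u} (Fin N) α s)
    {correct : (Finset (Fin N) → ℤ) → α → Prop}
    (hc : ∀ v, ¬(correct (fun S => (S.card : ℤ)) v ∧ correct (fun S => -(S.card : ℤ)) v))
    (hA : A.SucceedsWithProb correct (2 / 3)) : 1 ≤ s := by
  by_contra hs
  obtain rfl : s = 0 := by omega
  exact A.not_succeedsWithProb (ι := Unit) (fun _ => isInstance_card)
    (fun _ => isInstance_neg_card) (fun _ => hc) (fun ω => by simp [Algorithm.transcript]) hA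

theorem not_isMinValue_card_neg_card (hN : 2 ≤ N) (v : ℤ) :
    ¬(IsMinValue (fun S : Finset (Fin N) => (S.card : ℤ)) v ∧
      IsMinValue (fun S : Finset (Fin N) => -(S.card : ℤ)) v) := by
  rintro ⟨⟨⟨S, rfl⟩, -⟩, -, h⟩
  have := h ⟨Finset.univ, rfl⟩
  simp only [Finset.card_univ, Fintype.card_fin] at this
  omega

theorem not_isMinimizer_card_neg_card (hN : 2 ≤ N) (S : Finset (Fin N)) :
    ¬(IsMinimizer (fun S : Finset (Fin N) => (S.card : ℤ)) S ∧
      IsMinimizer (fun S : Finset (Fin N) => -(S.card : ℤ)) S) := by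
  rintro ⟨h1, h2⟩
  have h3 := h1 ∅
  have h4 := h2 Finset.univ
  simp only [Finset.card_univ, Fintype.card_fin, Finset.card_empty] at h3 h4
  omega

end NoRounds

/-! ### Choice of parameters -/

section Parameters

open Real

/-- The choice of the number of levels and of the tolerance. -/
theorem exists_parameters {N s : ℕ} (hN : 2 ≤ N) {c : ℝ} (hc : 1 ≤ c) (hs : 1 ≤ s)
    (hlt : (s : ℝ) < 1 / 100 * ((N : ℝ) ^ (1 / 3 : ℝ) / (c * log N) ^ (1 / 3 : ℝ))) :
    ∃ g m : ℕ, 1 ≤ g ∧ s ≤ m + 1 ∧ rowSize g (m + 2) * (2 * (m + 2)) ≤ N ∧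
      3 * (s * (2 * (m + 2)) ^ 2 *
        ((N : ℝ) ^ c * exp (-((g : ℝ) ^ 2 / (2 * rowSize g (m + 2)))))) < 1 := by
  have hN' : (2 : ℝ) ≤ N := by exact_mod_cast hN
  have hlogN : 0.69 ≤ log N := by
    have h1 := log_two_gt_d9
    have h2 := log_le_log (by norm_num) hN'
    linarith
  set L : ℝ := c * log N with hL
  have hLlog : log N ≤ L := by nlinarith
  have hL0 : 0.69 ≤ L := hlogN.trans hLlog
  set ρ : ℝ := (N : ℝ) ^ (1 / 3 : ℝ) / L ^ (1 / 3 : ℝ) with hρ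
  have hρ3 : ρ ^ 3 = N / L := by
    rw [hρ, ← div_rpow (by positivity) (by positivity), ← rpow_natCast, ← rpow_mul (by positivity)]
    norm_num
  have hs' : (1 : ℝ) ≤ s := by exact_mod_cast hs
  have hρ0 : 100 < ρ := by linarith
  set R : ℕ := ⌈1 / 100 * ρ⌉₊ with hR
  have hsR : s < R := Nat.lt_ceil.2 hlt
  have hRρ : (R : ℝ) ≤ 1 / 50 * ρ := by
    have := Nat.ceil_lt_add_one (a := 1 / 100 * ρ) (by linarith)
    linarith
  have hR2 : (2 : ℝ) ≤ R := by exact_mod_cast (by omega : 2 ≤ R)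
  have hR3 : (R : ℝ) ^ 3 * L ≤ 8 / 1000000 * N := by
    have h1 : (R : ℝ) ^ 3 ≤ (1 / 50 * ρ) ^ 3 := pow_le_pow_left₀ (by positivity) hRρ 3
    rw [mul_pow, hρ3] at h1
    have h2 := mul_le_mul_of_nonneg_right h1 (by linarith : 0 ≤ L)
    refine h2.trans_eq ?_
    field_simp
    norm_num
  have hR3N : (R : ℝ) ^ 3 ≤ 12 / 1000000 * N := by
    have : (R : ℝ) ^ 3 * 0.69 ≤ R ^ 3 * L := mul_le_mul_of_nonneg_left hL0 (by positivity)
    linarith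
  have hR2N : 76 * (R : ℝ) ^ 2 ≤ N := by
    have : (R : ℝ) ^ 2 * 2 ≤ R ^ 2 * R := mul_le_mul_of_nonneg_left hR2 (by positivity)
    nlinarith
  have hR0 : (0 : ℝ) < R := by linarith
  -- A row has at most `38 * g * R` elements, so the `2 * R` rows fit into `N`.
  set g : ℕ := ⌊(N : ℝ) / (76 * R ^ 2)⌋₊ with hg
  have h1x : 1 ≤ (N : ℝ) / (76 * R ^ 2) := by rwa [le_div_iff₀ (by positivity), one_mul]
  have hg1 : 1 ≤ g := Nat.le_floor (by simpa using h1x)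
  have hgle : (g : ℝ) * (76 * R ^ 2) ≤ N :=
    (le_div_iff₀ (by positivity)).1 (Nat.floor_le (by positivity))
  have hgge : (N : ℝ) ≤ g * (152 * R ^ 2) := by
    have h2 := Nat.lt_floor_add_one ((N : ℝ) / (76 * R ^ 2))
    have h3 : (1 : ℝ) ≤ g := by exact_mod_cast hg1
    have h4 : (N : ℝ) / (76 * R ^ 2) ≤ 2 * g := by linarith
    rw [div_le_iff₀ (by positivity)] at h4
    linarith
  have hg0 : (0 : ℝ) < g := by exact_mod_cast hg1
  have hm : R - 2 + 2 = R := by omega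
  have hmR : ((R - 2 : ℕ) : ℝ) + 2 = R := by exact_mod_cast hm
  have hn : (rowSize g R : ℝ) ≤ 38 * (g * R) := by
    have : (g : ℝ) * 1 ≤ g * R := mul_le_mul_of_nonneg_left (by linarith) hg0.le
    simp only [rowSize]; push_cast; linarith
  have hn0 : (0 : ℝ) < rowSize g R := by simp only [rowSize]; push_cast; positivity
  refine ⟨g, R - 2, hg1, by omega, ?_, ?_⟩
  · rw [hm]
    have h2 := mul_le_mul_of_nonneg_right hn (by positivity : (0 : ℝ) ≤ 2 * R)
    have : (rowSize g R : ℝ) * (2 * R) ≤ N := by linarith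
    exact_mod_cast this
  · rw [hm, hmR]
    -- The exponent is at least `g / (76 * R)`, of order `N / R ^ 3`; the factor 10 beats both `N ^
    -- c = exp L` and the at most `4 * R ^ 3` choices of round and row pair.
    have h2 : 10 * L ≤ (g : ℝ) ^ 2 / (2 * rowSize g R) := by
      rw [le_div_iff₀ (by positivity)]
      have h3 : 10 * L * (2 * rowSize g R) ≤ 10 * L * (2 * (38 * (g * R))) :=
        mul_le_mul_of_nonneg_left (by linarith) (by linarith)
      have h4 : 760 * L * R ^ 3 ≤ g * R ^ 2 := by nlinarith
      have h5 : 760 * L * R ≤ g := by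
        refine le_of_mul_le_mul_right ?_ (by positivity : (0 : ℝ) < R ^ 2)
        linarith
      nlinarith
    have h3 : (N : ℝ) ≤ exp L := by
      calc (N : ℝ) = exp (log N) := (exp_log (by linarith)).symm
        _ ≤ exp L := exp_le_exp.2 hLlog
    have h4 : (N : ℝ) ^ c = exp L := by
      rw [rpow_def_of_pos (by linarith), mul_comm, hL]
    have h5 : exp (-((g : ℝ) ^ 2 / (2 * rowSize g R))) ≤ exp (-(10 * L)) :=
      exp_le_exp.2 (by linarith)
    have h6 : (s : ℝ) * (2 * R) ^ 2 ≤ 1 / 12 * exp L := by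
      have h7 : (s : ℝ) ≤ R := by exact_mod_cast hsR.le
      have h8 : (s : ℝ) * (2 * R) ^ 2 ≤ R * (2 * R) ^ 2 :=
        mul_le_mul_of_nonneg_right h7 (by positivity)
      linarith
    have h7 : (s : ℝ) * (2 * R) ^ 2 * ((N : ℝ) ^ c * exp (-((g : ℝ) ^ 2 / (2 * rowSize g R)))) ≤
        1 / 12 * exp L * (exp L * exp (-(10 * L))) := by
      rw [h4]
      gcongr
    have h8 : exp L * (exp L * exp (-(10 * L))) ≤ 1 := by
      rw [← exp_add, ← exp_add, exp_le_one_iff]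
      linarith
    linarith

end Parameters

end ParallelSFM

/-- First conjunct: algorithms that only output the minimum value. Second conjunct: algorithms
that output a minimizing set. Both only have to be correct for functions with range in
`{-N, …, N}`. -/
theorem theorem1 (δ : ℝ) (hδ : 0 < δ) :
    ∃ κ : ℝ, 0 < κ ∧ ∀ N : ℕ, 2 ≤ N → ∀ c : ℝ, 1 ≤ c → c ≤ (N : ℝ) ^ (1 - δ) → ∀ s : ℕ,
      (∀ A : ParallelSFM.RandomizedAlgorithm.{u} (Fin N) ℤ s,
        A.MakesAtMost ((N : ℝ) ^ c) →
        A.SucceedsWithProb ParallelSFM.IsMinValue (2 / 3) →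
        κ * ((N : ℝ) ^ (1 / 3 : ℝ) / (c * Real.log N) ^ (1 / 3 : ℝ)) ≤ s) ∧
      (∀ A : ParallelSFM.RandomizedAlgorithm.{u} (Fin N) (Finset (Fin N)) s,
        A.MakesAtMost ((N : ℝ) ^ c) →
        A.SucceedsWithProb ParallelSFM.IsMinimizer (2 / 3) →
        κ * ((N : ℝ) ^ (1 / 3 : ℝ) / (c * Real.log N) ^ (1 / 3 : ℝ)) ≤ s) := by
  refine ⟨1 / 100, by norm_num, fun N hN c hc _ s => ⟨fun A hq hA => ?_, fun A hq hA => ?_⟩⟩ <;>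
    by_contra! hlt
  · obtain ⟨g, m, hg, hs, hgN, hsmall⟩ := ParallelSFM.exists_parameters hN hc
      (A.rounds_pos (ParallelSFM.not_isMinValue_card_neg_card hN) hA) hlt
    exact A.not_succeedsWithProb_of_few_rounds hg hs hgN hsmall hq
      (fun p σ v hp => ParallelSFM.not_isMinValue_both hg hp σ (by omega) v) hA
  · obtain ⟨g, m, hg, hs, hgN, hsmall⟩ := ParallelSFM.exists_parameters hN hc
      (A.rounds_pos (ParallelSFM.not_isMinimizer_card_neg_card hN) hA) hlt
    exact A.not_succeedsWithProb_of_few_rounds hg hs hgN hsmall hq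
      (fun p σ S hp => ParallelSFM.not_isMinimizer_both hg hp σ (by omega) S) hA
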